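/- Let $d \ge 0$ be an integer and let $p \in \mathbb{C}[z_1,\dots,z_d]$. Then $\|p(T)\| \le 1$ for every $d$-tuple $T=(T_1,\dots,T_d)$ of commuting contractive operators ($\|T_j\|\le 1$) on a complex Hilbert space if and only if $\|p(M)\| \le 1$ for every $d$-tuple $M=(M_1,\dots,M_d)$ of commuting contractive nilpotent complex $n \times n$ matrices, of any size $n$ (with the operator norm induced by the Euclidean norm on $\mathbb{C}^n$). Moreover, the Agler norm $$\|p\|_A = \sup_T \|p(T)\|,$$ where $T$ ranges over all $d$-tuples of commuting contractive operators on a complex Hilbert space, is finite, and $$\|p\|_A = \sup_M \|p(M)\|,$$ where $M$ ranges over all $d$-tuples of commuting contractive nilpotent complex matrices of any size. -/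

import Mathlib

-- Complex square matrices carry the operator norm for the Euclidean norm on ℂⁿ.
open scoped Matrix.Norms.L2Operator
universe u


/-- `p(T) = ∑ α, p_α T₁^{α₁} ⋯ T_d^{α_d}`. The monomials are multiplied in the order of the
indices; for commuting tuples the order is irrelevant. -/
noncomputable def polyEval {d : ℕ} {A : Type*} [Ring A] [Algebra ℂ A]
    (p : MvPolynomial (Fin d) ℂ) (T : Fin d → A) : A :=
  ∑ α ∈ p.support, p.coeff α • (List.ofFn fun j => T j ^ α j).prod

/-- A `d`-tuple of commuting contractions in a normed ring (of operators or of matrices). -/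
structure IsCommutingContractive {d : ℕ} {A : Type*} [NormedRing A] (T : Fin d → A) : Prop where
  commute : ∀ i j, Commute (T i) (T j)
  norm_le_one : ∀ j, ‖T j‖ ≤ 1

/-- The numbers `‖p(T)‖`, for `d`-tuples `T` of commuting contractive operators on complex Hilbert
spaces. -/
def operatorValues {d : ℕ} (p : MvPolynomial (Fin d) ℂ) : Set ℝ :=
  {r | ∃ (H : Type u) (_ : NormedAddCommGroup H) (_ : InnerProductSpace ℂ H) (_ : CompleteSpace H)
    (T : Fin d → (H →L[ℂ] H)), IsCommutingContractive T ∧ r = ‖polyEval p T‖}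

/-- The numbers `‖p(M)‖`, for `d`-tuples `M` of commuting contractive nilpotent matrices of any
size. -/
def nilpotentValues {d : ℕ} (p : MvPolynomial (Fin d) ℂ) : Set ℝ :=
  {r | ∃ (n : ℕ) (M : Fin d → Matrix (Fin n) (Fin n) ℂ),
    IsCommutingContractive M ∧ (∀ j, IsNilpotent (M j)) ∧ r = ‖polyEval p M‖}

/-- The Agler norm of `p`: the supremum of `‖p(T)‖` over all `d`-tuples `T` of commuting contractive
operators on a Hilbert space. -/
noncomputable def aglerNorm {d : ℕ} (p : MvPolynomial (Fin d) ℂ) : ℝ :=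
  sSup (operatorValues.{u} p)

/-! Matrices act on Euclidean spaces, so only the passage from nilpotent matrices to operators is
hard. Replace each `T j` by the shift on `H^(N+1)` weighted by `T j`: these shifts are commuting
nilpotent contractions. At a constant sequence `(x, …, x)` a polynomial in them equals `p(T) x` in
all but the first `m` coordinates, with `m` independent of `N`
(`exists_polyEval_weightedShift_apply`). Restricting to a finite-dimensional invariant subspace
gives matrices (`exists_matrix_of_invariant`). A bound `C` for these yields `n ‖p(T) x‖² ≤ (n + m)
C² ‖x‖²`, and `n → ∞` gives `‖p(T)‖ ≤ C`. -/

/-! ### Transfer of polynomial values along relations and homomorphisms -/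

section polyEval

variable {d : ℕ} {A B : Type*} [Ring A] [Algebra ℂ A] [Ring B] [Algebra ℂ B]

/-- A relation between two algebras that respects the operations and holds between the entries of
two tuples holds between the values of a polynomial at these tuples. -/
theorem polyEval_rel (R : A → B → Prop) (zero : R 0 0) (one : R 1 1)
    (add : ∀ a b a' b', R a b → R a' b' → R (a + a') (b + b'))
    (mul : ∀ a b a' b', R a b → R a' b' → R (a * a') (b * b'))
    (smul : ∀ (c : ℂ) a b, R a b → R (c • a) (c • b))
    (p : MvPolynomial (Fin d) ℂ) {T : Fin d → A} {S : Fin d → B} (h : ∀ j, R (T j) (S j)) :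
    R (polyEval p T) (polyEval p S) := by
  have pow : ∀ a b, R a b → ∀ k : ℕ, R (a ^ k) (b ^ k) := by
    intro a b hab k
    induction k with
    | zero => simpa using one
    | succ k ih => rw [pow_succ, pow_succ]; exact mul _ _ _ _ ih hab
  have prod : ∀ (n : ℕ) (f : Fin n → A) (g : Fin n → B), (∀ i, R (f i) (g i)) →
      R (List.ofFn f).prod (List.ofFn g).prod := by
    intro n
    induction n with
    | zero => intro f g _; simpa using one
    | succ n ih =>
      intro f g hfg
      rw [List.ofFn_succ, List.ofFn_succ, List.prod_cons, List.prod_cons]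
      exact mul _ _ _ _ (hfg 0) (ih _ _ fun i => hfg i.succ)
  unfold polyEval
  induction p.support using Finset.cons_induction with
  | empty => simpa using zero
  | cons α s hα ih =>
    rw [Finset.sum_cons, Finset.sum_cons]
    exact add _ _ _ _ (smul _ _ _ (prod _ _ _ fun j => pow _ _ (h j) _)) ih

theorem map_polyEval {F : Type*} [FunLike F A B] [AlgHomClass F ℂ A B] (φ : F) (p : MvPolynomial (Fin d) ℂ) (T : Fin d → A) :
    φ (polyEval p T) = polyEval p fun j => φ (T j) :=
  polyEval_rel (fun a b => φ a = b) (map_zero φ) (map_one φ)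
    (by rintro a _ a' _ rfl rfl; exact map_add φ _ _)
    (by rintro a _ a' _ rfl rfl; exact map_mul φ _ _)
    (by rintro c a _ rfl; exact map_smul φ c a) p fun _ => rfl

end polyEval

/-! ### Norm bounds and restriction to invariant subspaces -/

section Operators

variable {d : ℕ} {E K : Type*} [NormedAddCommGroup E] [InnerProductSpace ℂ E]
  [NormedAddCommGroup K] [InnerProductSpace ℂ K]

theorem polyEval_intertwine (ι : E →ₗ[ℂ] K) {A : Fin d → (E →L[ℂ] E)} {M : Fin d → (K →L[ℂ] K)}
    (h : ∀ j w, ι (A j w) = M j (ι w)) (p : MvPolynomial (Fin d) ℂ) (w : E) :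
    ι (polyEval p A w) = polyEval p M (ι w) := by
  revert w
  refine polyEval_rel (fun (a : E →L[ℂ] E) (b : K →L[ℂ] K) => ∀ w, ι (a w) = b (ι w)) ?_ ?_ ?_ ?_ ?_ p h
  · simp
  · simp
  · intro a b a' b' h h' w; simp [h, h']
  · intro a b a' b' h h' w; simp [h, h']
  · intro c a b h w; simp [h]

theorem intertwine_pow (ι : E →ₗ[ℂ] K) {a : E →L[ℂ] E} {b : K →L[ℂ] K}
    (h : ∀ w, ι (a w) = b (ι w)) (k : ℕ) (w : E) : ι ((a ^ k) w) = (b ^ k) (ι w) := by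
  induction k generalizing w with
  | zero => simp
  | succ k ih =>
    rw [pow_succ, pow_succ]
    exact (ih _).trans (congrArg _ (h w))

/-- A bound for the values of a polynomial at commuting contractions on a Hilbert space. -/
theorem norm_polyEval_le (p : MvPolynomial (Fin d) ℂ) {T : Fin d → (K →L[ℂ] K)}
    (hT : ∀ j, ‖T j‖ ≤ 1) : ‖polyEval p T‖ ≤ ∑ α ∈ p.support, ‖p.coeff α‖ := by
  -- Only an inequality, since `K` may be trivial.
  have one : ‖(1 : K →L[ℂ] K)‖ ≤ 1 := ContinuousLinearMap.norm_id_le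
  have pow : ∀ a : K →L[ℂ] K, ‖a‖ ≤ 1 → ∀ k : ℕ, ‖a ^ k‖ ≤ 1 := by
    intro a ha k
    induction k with
    | zero => simpa using one
    | succ k ih =>
      rw [pow_succ]
      exact (norm_mul_le _ _).trans (mul_le_one₀ ih (norm_nonneg _) ha)
  have prod : ∀ l : List (K →L[ℂ] K), (∀ a ∈ l, ‖a‖ ≤ 1) → ‖l.prod‖ ≤ 1 := by
    intro l
    induction l with
    | nil => intro _; simpa using one
    | cons a l ih =>
      intro h
      rw [List.prod_cons]
      exact (norm_mul_le _ _).trans (mul_le_one₀ (h a (by simp)) (norm_nonneg _)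
        (ih fun b hb => h b (by simp [hb])))
  refine (norm_sum_le _ _).trans (Finset.sum_le_sum fun α _ => ?_)
  rw [norm_smul]
  refine mul_le_of_le_one_right (norm_nonneg _) (prod _ fun a ha => ?_)
  obtain ⟨j, rfl⟩ := (List.mem_ofFn' _ _).1 ha
  exact pow _ (hT j) _

variable [CompleteSpace K]

/-- Matrices intertwined with commuting nilpotent contractions by an isometry onto an invariant
subspace. -/
theorem exists_matrix_of_invariant {M : Fin d → (K →L[ℂ] K)} (hM : IsCommutingContractive M)
    (hnil : ∀ j, IsNilpotent (M j)) (V : Submodule ℂ K) [FiniteDimensional ℂ V]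
    (hV : ∀ j, ∀ v ∈ V, M j v ∈ V) :
    ∃ (n : ℕ) (A : Fin d → Matrix (Fin n) (Fin n) ℂ), IsCommutingContractive A ∧
      (∀ j, IsNilpotent (A j)) ∧
      ∀ (p : MvPolynomial (Fin d) ℂ), ∀ v ∈ V, ‖polyEval p M v‖ ≤ ‖polyEval p A‖ * ‖v‖ := by
  let n := Module.finrank ℂ V
  let φ := Matrix.toEuclideanCLM (n := Fin n) (𝕜 := ℂ)
  let ι : EuclideanSpace ℂ (Fin n) →ₗᵢ[ℂ] K :=
    V.subtypeₗᵢ.comp (stdOrthonormalBasis ℂ V).repr.symm.toLinearIsometry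
  let ι' : EuclideanSpace ℂ (Fin n) →L[ℂ] K := ι.toContinuousLinearMap
  have hι : ∀ v ∈ V, ∃ w, ι w = v := fun v hv =>
    ⟨(stdOrthonormalBasis ℂ V).repr ⟨v, hv⟩, by simp [ι]⟩
  have hιV : ∀ w, ι w ∈ V := fun w => by simp [ι]
  have hadj : ∀ w, ContinuousLinearMap.adjoint ι' (ι' w) = w := fun w => by
    refine ext_inner_right ℂ fun u => ?_
    rw [ContinuousLinearMap.adjoint_inner_left]
    exact ι.inner_map_map w u
  -- The compression of `M j` to `V`; invariance of `V` makes it the restriction, so that `ι`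
  -- intertwines the two.
  let B : Fin d → (EuclideanSpace ℂ (Fin n) →L[ℂ] EuclideanSpace ℂ (Fin n)) := fun j =>
    (ContinuousLinearMap.adjoint ι').comp ((M j).comp ι')
  have hB : ∀ j w, ι.toLinearMap (B j w) = M j (ι.toLinearMap w) := by
    intro j w
    obtain ⟨u, hu⟩ := hι _ (hV j _ (hιV w))
    have : B j w = u := by
      change ContinuousLinearMap.adjoint ι' (M j (ι w)) = u
      rw [← hu]; exact hadj u
    rw [this]; exact hu
  have hBnorm : ∀ j, ‖B j‖ ≤ 1 := fun j => by
    refine ContinuousLinearMap.opNorm_le_bound _ zero_le_one fun w => ?_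
    rw [← ι.norm_map, one_mul]
    refine (congrArg _ (hB j w)).trans_le ?_
    refine ((M j).le_of_opNorm_le (hM.norm_le_one j) _).trans_eq ?_
    rw [one_mul]; exact ι.norm_map w
  have key : ∀ p : MvPolynomial (Fin d) ℂ,
      φ (polyEval p fun j => φ.symm (B j)) = polyEval p B := fun p => by
    simp [map_polyEval]
  refine ⟨n, fun j => φ.symm (B j), ⟨fun i j => ?_, fun j => ?_⟩, fun j => ?_, fun p v hv => ?_⟩
  · have : Commute (B i) (B j) := by
      refine ContinuousLinearMap.ext fun w => ι.injective ?_
      have h1 := hB i (B j w)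
      have h2 := hB j (B i w)
      have h3 : M i (M j (ι w)) = M j (M i (ι w)) := DFunLike.congr_fun (hM.commute i j) (ι w)
      refine h1.trans (Eq.trans ?_ h2.symm)
      exact (congrArg _ (hB j w)).trans (h3.trans (congrArg _ (hB i w)).symm)
    exact this.map φ.symm
  · rw [Matrix.cstar_norm_def]
    exact (congrArg norm (φ.apply_symm_apply (B j))).trans_le (hBnorm j)
  · obtain ⟨k, hk⟩ := hnil j
    refine IsNilpotent.map (f := φ.symm) ⟨k, ContinuousLinearMap.ext fun w => ι.injective ?_⟩
    refine (intertwine_pow ι.toLinearMap (hB j) k w).trans ?_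
    simp [hk]
  · obtain ⟨w, rfl⟩ := hι v hv
    have h1 := polyEval_intertwine ι.toLinearMap hB p w
    have h2 : ‖polyEval p fun j => φ.symm (B j)‖ = ‖polyEval p B‖ := by
      rw [← key]; rfl
    rw [h2, ι.norm_map]
    refine (congrArg norm h1).symm.trans_le ?_
    exact (ι.norm_map _).trans_le (ContinuousLinearMap.le_opNorm _ _)

end Operators

/-- Norms of polynomials at commuting contractive matrices are values at commuting contractions on
a Hilbert space, in any universe. -/
theorem norm_polyEval_matrix_mem_operatorValues {d n : ℕ} (p : MvPolynomial (Fin d) ℂ)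
    {M : Fin d → Matrix (Fin n) (Fin n) ℂ} (hM : IsCommutingContractive M) :
    ‖polyEval p M‖ ∈ operatorValues.{u} p := by
  let φ := Matrix.toEuclideanCLM (n := Fin n) (𝕜 := ℂ)
  let e : EuclideanSpace ℂ (Fin n) ≃ₗᵢ[ℂ] EuclideanSpace ℂ (ULift.{u} (Fin n)) :=
    LinearIsometryEquiv.piLpCongrLeft 2 ℂ ℂ Equiv.ulift.symm
  let χ := φ.trans e.conjStarAlgEquiv
  -- Injective star homomorphisms of C⋆-algebras are isometric.
  have hχ : ∀ a, ‖χ a‖ = ‖a‖ := NonUnitalStarAlgHom.norm_map χ χ.injective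
  refine ⟨EuclideanSpace ℂ (ULift.{u} (Fin n)), inferInstance, inferInstance, inferInstance,
    fun j => χ (M j), ⟨fun i j => (hM.commute i j).map χ, fun j => ?_⟩, ?_⟩
  · rw [hχ]; exact hM.norm_le_one j
  · rw [← map_polyEval, hχ]

/-! ### Weighted shifts and the limiting argument -/

section Shift

variable {H : Type*} [NormedAddCommGroup H] [InnerProductSpace ℂ H]

/-- The operator `(x₀, …, x_N) ↦ (0, a x₀, …, a x_{N-1})`. -/
noncomputable def weightedShift (N : ℕ) (a : H →L[ℂ] H) :
    PiLp 2 (fun _ : Fin (N + 1) => H) →L[ℂ] PiLp 2 (fun _ : Fin (N + 1) => H) :=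
  LinearMap.mkContinuous
    { toFun := fun f => WithLp.toLp 2 (Fin.cons 0 fun i : Fin N => a (f i.castSucc))
      map_add' := fun f g => by
        ext i
        refine Fin.cases ?_ (fun i => ?_) i <;> simp
      map_smul' := fun c f => by
        ext i
        refine Fin.cases ?_ (fun i => ?_) i <;> simp }
    ‖a‖ fun f => by
      refine le_of_sq_le_sq ?_ (by positivity)
      rw [mul_pow, PiLp.norm_sq_eq_of_L2, PiLp.norm_sq_eq_of_L2, Fin.sum_univ_succ,
        Fin.sum_univ_castSucc, mul_add, Finset.mul_sum]
      simp only [LinearMap.coe_mk, AddHom.coe_mk, Fin.cons_zero, Fin.cons_succ, norm_zero]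
      have : ∀ i : Fin N, ‖a (f i.castSucc)‖ ^ 2 ≤ ‖a‖ ^ 2 * ‖f i.castSucc‖ ^ 2 := fun i => by
        rw [← mul_pow]
        exact pow_le_pow_left₀ (norm_nonneg _) (a.le_opNorm _) 2
      have h := Finset.sum_le_sum fun i (_ : i ∈ Finset.univ) => this i
      have h' : 0 ≤ ‖a‖ ^ 2 * ‖f (Fin.last N)‖ ^ 2 := by positivity
      linarith

variable {N : ℕ}

@[simp]
theorem weightedShift_zero (a : H →L[ℂ] H) (f : PiLp 2 fun _ : Fin (N + 1) => H) :
    weightedShift N a f 0 = 0 := rfl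

@[simp]
theorem weightedShift_succ (a : H →L[ℂ] H) (f : PiLp 2 fun _ : Fin (N + 1) => H) (i : Fin N) :
    weightedShift N a f i.succ = a (f i.castSucc) := rfl

theorem norm_weightedShift_le (a : H →L[ℂ] H) : ‖weightedShift N a‖ ≤ ‖a‖ :=
  LinearMap.mkContinuous_norm_le _ (norm_nonneg a) _

theorem commute_weightedShift {a b : H →L[ℂ] H} (h : Commute a b) :
    Commute (weightedShift N a) (weightedShift N b) := by
  refine ContinuousLinearMap.ext fun f => ?_
  ext i
  change weightedShift N a (weightedShift N b f) i = weightedShift N b (weightedShift N a f) i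
  refine Fin.cases rfl (fun i => ?_) i
  rw [weightedShift_succ, weightedShift_succ]
  cases N with
  | zero => exact i.elim0
  | succ N =>
    -- Index 1 receives the zero that the inner shift puts at index 0.
    refine Fin.cases ?_ (fun i => ?_) i
    · simp
    · rw [← Fin.succ_castSucc, weightedShift_succ, weightedShift_succ]
      exact DFunLike.congr_fun h _

theorem weightedShift_pow_apply_of_lt (a : H →L[ℂ] H) (k : ℕ)
    (f : PiLp 2 fun _ : Fin (N + 1) => H) (i : Fin (N + 1)) (hi : (i : ℕ) < k) :
    (weightedShift N a ^ k) f i = 0 := by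
  induction k generalizing i with
  | zero => omega
  | succ k ih =>
    rw [pow_succ']
    change weightedShift N a ((weightedShift N a ^ k) f) i = 0
    induction i using Fin.cases with
    | zero => rfl
    | succ i =>
      rw [weightedShift_succ, ih _ (by simpa using hi), map_zero]

theorem isNilpotent_weightedShift (a : H →L[ℂ] H) : IsNilpotent (weightedShift N a) :=
  ⟨N + 1, ContinuousLinearMap.ext fun f => by
    ext i
    exact weightedShift_pow_apply_of_lt a _ f i i.isLt⟩

/-- On constant sequences, a polynomial in the weighted shifts eventually acts
as the same polynomial in the weights, with a delay that does not depend on the length. -/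
theorem exists_polyEval_weightedShift_apply {d : ℕ} (p : MvPolynomial (Fin d) ℂ)
    (T : Fin d → (H →L[ℂ] H)) :
    ∃ m : ℕ, ∀ (N : ℕ) (x : H) (i : Fin (N + 1)), m ≤ i →
      polyEval p (fun j => weightedShift N (T j)) (WithLp.toLp 2 fun _ => x) i =
        polyEval p T x := by
  -- Working in the product algebra over all `N` forces one delay `m` for every length. Quantifying
  -- over the start `k` lets delays add under products.
  let A := ∀ N : ℕ,
    PiLp 2 (fun _ : Fin (N + 1) => H) →L[ℂ] PiLp 2 (fun _ : Fin (N + 1) => H)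
  let R : A → (H →L[ℂ] H) → Prop := fun a b => ∃ m : ℕ,
    ∀ (N : ℕ) (k : ℕ) (f : PiLp 2 fun _ : Fin (N + 1) => H) (x : H),
      (∀ i : Fin (N + 1), k ≤ (i : ℕ) → f i = x) →
        ∀ i : Fin (N + 1), k + m ≤ (i : ℕ) → a N f i = b x
  have h : R (polyEval p fun j N => weightedShift N (T j)) (polyEval p T) := by
    refine polyEval_rel R ?_ ?_ ?_ ?_ ?_ p fun j => ?_
    · exact ⟨0, fun N k f x _ i _ => rfl⟩
    · exact ⟨0, fun N k f x hf i hi => hf i hi⟩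
    · rintro a b a' b' ⟨m, h⟩ ⟨m', h'⟩
      refine ⟨m + m', fun N k f x hf i hi => ?_⟩
      have h1 := h N k f x hf i (by omega)
      have h2 := h' N k f x hf i (by omega)
      exact congrArg₂ (· + ·) h1 h2
    · rintro a b a' b' ⟨m, h⟩ ⟨m', h'⟩
      refine ⟨m + m', fun N k f x hf i hi => ?_⟩
      exact h N (k + m') (a' N f) (b' x) (h' N k f x hf) i (by omega)
    · rintro c a b ⟨m, h⟩
      exact ⟨m, fun N k f x hf i hi => congrArg (c • ·) (h N k f x hf i hi)⟩
    · refine ⟨1, fun N k f x hf i hi => ?_⟩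
      induction i using Fin.cases with
      | zero => simp at hi
      | succ i => rw [weightedShift_succ, hf _ (by simpa using hi)]
  obtain ⟨m, h⟩ := h
  refine ⟨m, fun N x i hi => ?_⟩
  have h1 := h N 0 (WithLp.toLp 2 fun _ => x) x (fun _ _ => rfl) i (by omega)
  rw [← h1]
  have h2 := map_polyEval (Pi.evalAlgHom ℂ (fun N : ℕ =>
    PiLp 2 (fun _ : Fin (N + 1) => H) →L[ℂ] PiLp 2 (fun _ : Fin (N + 1) => H)) N) p
    fun j N => weightedShift N (T j)
  exact congrArg (fun a : PiLp 2 (fun _ : Fin (N + 1) => H) →L[ℂ]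
    PiLp 2 (fun _ : Fin (N + 1) => H) => a (WithLp.toLp 2 fun _ => x) i) h2.symm

/-- The span of the vectors obtained from `x` by applying at most `n` of the operators `T j`. -/
noncomputable def orbitSpan {d : ℕ} (T : Fin d → (H →L[ℂ] H)) (x : H) : ℕ → Submodule ℂ H
  | 0 => Submodule.span ℂ {x}
  | n + 1 => orbitSpan T x n ⊔ ⨆ j, (orbitSpan T x n).map (T j : H →ₗ[ℂ] H)

theorem finiteDimensional_orbitSpan {d : ℕ} (T : Fin d → (H →L[ℂ] H)) (x : H) (n : ℕ) :
    FiniteDimensional ℂ (orbitSpan T x n) := by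
  induction n with
  | zero => exact inferInstanceAs (FiniteDimensional ℂ (Submodule.span ℂ {x}))
  | succ n ih =>
    exact inferInstanceAs (FiniteDimensional ℂ
      ↑(orbitSpan T x n ⊔ ⨆ j, (orbitSpan T x n).map (T j : H →ₗ[ℂ] H)))

theorem mem_orbitSpan {d : ℕ} (T : Fin d → (H →L[ℂ] H)) (x : H) (n : ℕ) :
    x ∈ orbitSpan T x n := by
  induction n with
  | zero => exact Submodule.mem_span_singleton_self x
  | succ n ih => exact Submodule.mem_sup_left ih

theorem apply_mem_orbitSpan {d : ℕ} (T : Fin d → (H →L[ℂ] H)) (x : H) {n : ℕ} (j : Fin d) {y : H}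
    (hy : y ∈ orbitSpan T x n) : T j y ∈ orbitSpan T x (n + 1) :=
  Submodule.mem_sup_right <| Submodule.mem_iSup_of_mem j <| Submodule.mem_map_of_mem hy

/-- A bound for a polynomial on commuting contractive nilpotent matrices holds on commuting
contractions of any Hilbert space. -/
theorem norm_polyEval_le_of_nilpotent [CompleteSpace H] {d : ℕ} {p : MvPolynomial (Fin d) ℂ}
    {C : ℝ} (hC : ∀ (n : ℕ) (M : Fin d → Matrix (Fin n) (Fin n) ℂ),
      IsCommutingContractive M → (∀ j, IsNilpotent (M j)) → ‖polyEval p M‖ ≤ C)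
    {T : Fin d → (H →L[ℂ] H)} (hT : IsCommutingContractive T) : ‖polyEval p T‖ ≤ C := by
  have hC0 : 0 ≤ C := (norm_nonneg _).trans
    (hC 0 (fun _ => 0) ⟨fun _ _ => Commute.refl _, fun _ => by simp⟩ fun _ => IsNilpotent.zero)
  obtain ⟨m, hm⟩ := exists_polyEval_weightedShift_apply p T
  refine ContinuousLinearMap.opNorm_le_bound _ hC0 fun x => ?_
  have key : ∀ n : ℕ, n * ‖polyEval p T x‖ ^ 2 ≤ (n + m) * (C * ‖x‖) ^ 2 := by
    intro n
    cases n with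
    | zero => simp only [Nat.cast_zero, zero_mul]; positivity
    | succ n =>
    -- Of the `N + 1 = (n + 1) + m` coordinates, the last `n + 1` equal `p(T) x`.
    let N := n + m
    let v : PiLp 2 (fun _ : Fin (N + 1) => H) := WithLp.toLp 2 fun _ => x
    -- A shift raises the index by one and applies one `T j`, matching the growth of `orbitSpan`;
    -- hence `V` is invariant.
    let V : Submodule ℂ (PiLp 2 fun _ : Fin (N + 1) => H) :=
      { carrier := {f | ∀ i : Fin (N + 1), f i ∈ orbitSpan T x i}
        add_mem' := fun hf hg i => Submodule.add_mem _ (hf i) (hg i)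
        zero_mem' := fun i => Submodule.zero_mem _
        smul_mem' := fun c f hf i => Submodule.smul_mem _ c (hf i) }
    have := finiteDimensional_orbitSpan T x
    let emb : V →ₗ[ℂ] ∀ i : Fin (N + 1), orbitSpan T x i :=
      { toFun := fun f i => ⟨f.1 i, f.2 i⟩
        map_add' := fun _ _ => rfl
        map_smul' := fun _ _ => rfl }
    have : FiniteDimensional ℂ V := Module.Finite.of_injective emb fun f g hfg => by
      ext i
      exact congrArg Subtype.val (congrFun hfg i)
    obtain ⟨k, A, hA, hAnil, hAv⟩ := exists_matrix_of_invariant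
      (M := fun j => weightedShift N (T j))
      ⟨fun i j => commute_weightedShift (hT.commute i j),
        fun j => (norm_weightedShift_le _).trans (hT.norm_le_one j)⟩
      (fun j => isNilpotent_weightedShift _) V (fun j f hf i => by
        induction i using Fin.cases with
        | zero => exact Submodule.zero_mem _
        | succ i => exact apply_mem_orbitSpan T x j (hf i.castSucc))
    have h1 := (hAv p v fun i => mem_orbitSpan T x i).trans
      (mul_le_mul_of_nonneg_right (hC k A hA hAnil) (norm_nonneg v))
    have h2 := pow_le_pow_left₀ (norm_nonneg _) h1 2
    have hv : ‖v‖ ^ 2 = (N + 1 : ℕ) * ‖x‖ ^ 2 := by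
      rw [PiLp.norm_sq_eq_of_L2]; simp [v]
    rw [mul_pow, hv, PiLp.norm_sq_eq_of_L2] at h2
    have h3 : ((n + 1 : ℕ) : ℝ) * ‖polyEval p T x‖ ^ 2 ≤ ∑ i : Fin (N + 1),
        ‖polyEval p (fun j => weightedShift N (T j)) v i‖ ^ 2 := by
      let g : Fin (n + 1) → Fin (N + 1) := fun i => ⟨i + m, by omega⟩
      have hg : Function.Injective g := fun i j hij => by
        have := congrArg Fin.val hij
        exact Fin.ext (by simpa [g] using this)
      refine le_trans (le_of_eq ?_) (Finset.sum_le_sum_of_subset_of_nonneg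
        (Finset.subset_univ (Finset.univ.map ⟨g, hg⟩)) fun _ _ _ => sq_nonneg _)
      rw [Finset.sum_map, Finset.sum_congr rfl fun i _ => by
        rw [Function.Embedding.coeFn_mk, hm N x (g i) (Nat.le_add_left m i)]]
      simp
    refine (h3.trans h2).trans_eq ?_
    push_cast [N]
    ring
  refine le_of_sq_le_sq ?_ (by positivity)
  -- If the bound failed, `key n` would break once `n` times the gap exceeds `m (C ‖x‖)²`.
  by_contra! hlt
  obtain ⟨n, hn⟩ := exists_nat_gt
    (m * (C * ‖x‖) ^ 2 / (‖polyEval p T x‖ ^ 2 - (C * ‖x‖) ^ 2))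
  rw [div_lt_iff₀ (sub_pos.2 hlt)] at hn
  linarith [key n]

end Shift

theorem theorem1 {d : ℕ} (p : MvPolynomial (Fin d) ℂ) :
    ((∀ (H : Type u) [NormedAddCommGroup H] [InnerProductSpace ℂ H] [CompleteSpace H]
        (T : Fin d → (H →L[ℂ] H)), IsCommutingContractive T → ‖polyEval p T‖ ≤ 1) ↔
      (∀ (n : ℕ) (M : Fin d → Matrix (Fin n) (Fin n) ℂ),
        IsCommutingContractive M → (∀ j, IsNilpotent (M j)) → ‖polyEval p M‖ ≤ 1)) ∧
    -- the supremum defining the Agler norm is finite, and nilpotent matrices give the same one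
    IsLUB (operatorValues.{u} p) (aglerNorm.{u} p) ∧
    IsLUB (nilpotentValues p) (aglerNorm.{u} p) := by
  have hsub : nilpotentValues p ⊆ operatorValues.{u} p := by
    rintro _ ⟨n, M, hM, -, rfl⟩
    exact norm_polyEval_matrix_mem_operatorValues p hM
  have hne : (operatorValues.{u} p).Nonempty :=
    ⟨_, norm_polyEval_matrix_mem_operatorValues p (n := 0) (M := fun _ => 0)
      ⟨fun _ _ => Commute.refl _, fun _ => by simp⟩⟩
  have hbdd : BddAbove (operatorValues.{u} p) := by
    refine ⟨∑ α ∈ p.support, ‖p.coeff α‖, ?_⟩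
    rintro _ ⟨H, _, _, _, T, hT, rfl⟩
    exact norm_polyEval_le p hT.norm_le_one
  have hlub : IsLUB (operatorValues.{u} p) (aglerNorm.{u} p) := isLUB_csSup hne hbdd
  refine ⟨⟨fun h n M hM _ => ?_, fun h H _ _ _ T hT => norm_polyEval_le_of_nilpotent h hT⟩, hlub,
    fun r hr => hlub.1 (hsub hr), fun b hb => hlub.2 ?_⟩
  · obtain ⟨H, _, _, _, T, hT, hr⟩ := norm_polyEval_matrix_mem_operatorValues.{u} p hM
    rw [hr]
    exact h H T hT
  -- Any upper bound `b` of the nilpotent values serves as `C`.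
  · rintro _ ⟨H, _, _, _, T, hT, rfl⟩
    exact norm_polyEval_le_of_nilpotent
      (fun n M hM hnil => hb ⟨n, M, hM, hnil, rfl⟩) hT
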